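/- A locally $C^*$-algebra is a complete Hausdorff complex topological $*$-algebra $A$ (not necessarily unital) whose topology is determined by the set $S(A)$ of its continuous $C^*$-seminorms. An approximate unit of $A$ is an increasing net $(e_i)$ of positive elements with $p(e_i)\le 1$ for all $p\in S(A)$ and $e_i a\to a$, $ae_i\to a$ for all $a\in A$. Let $G$ be a compact (Hausdorff) group. The commutative Kac $C^*$-algebra $C^*\mathbf K_G^a$ of $G$ is $C(G)$ with comultiplication $d\colon C(G)\to C(G)\otimes C(G)=C(G\times G)$, $(df)(s,t)=f(st)$ (together with the coinvolution $f\mapsto f(\,\cdot^{-1})$ and the Haar integral, which play no role below); $\sigma$ denotes the flip of $C(G)\otimes C(G)$. Since $C(G)$ is unital, $M(A,C(G))=A\otimes C(G)$, and this injective tensor product is identified with the algebra $C(G,A)$ of continuous functions with the topology of uniform convergence, $(a\otimes b)(t)=b(t)a$; likewise $A\otimes C(G)\otimes C(G)=C(G\times G,A)$. An action of $C^*\mathbf K_G^a$ on $A$ is an injective continuous $*$-homomorphism $\alpha\colon A\to C(G,A)$ such that (i) $\alpha$ is an $S$-morphism: for every approximate unit $(e_i)$ of $A$ the net $\alpha(e_i)$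 converges strictly to $1$, i.e. $\alpha(e_i)f\to f$ and $f\alpha(e_i)\to f$ for all $f\in C(G,A)$; (ii) $(\alpha\otimes\mathrm{id})\circ\alpha=(\mathrm{id}_A\otimes(\sigma\circ d))\circ\alpha$. The action $\alpha$ is an inverse limit action if there are an inverse system $(A_\delta)_{\delta\in\Delta}$ of $C^*$-algebras over a directed set, with connecting $*$-homomorphisms $\pi_{\delta\varepsilon}\colon A_\delta\to A_\varepsilon$ ($\delta\ge\varepsilon$), an isomorphism of topological $*$-algebras $A\cong\varprojlim_\delta A_\delta$ with canonical maps $\pi_\delta\colon A\to A_\delta$, and actions $\alpha^{(\delta)}$ of $C^*\mathbf K_G^a$ on $A_\delta$ such that $(\pi_{\delta\varepsilon}\otimes\mathrm{id})\circ\alpha^{(\delta)}=\alpha^{(\varepsilon)}\circ\pi_{\delta\varepsilon}$ for $\delta\ge\varepsilon$ and $(\pi_\delta\otimes\mathrm{id})\circ\alpha=\alpha^{(\delta)}\circ\pi_\delta$ for all $\delta$ (that is, $\alpha=\varprojlim_\delta\alpha^{(\delta)}$). Corollary 4.5. If $G$ is a compact group, then every action of $C^*\mathbf K_G^a$ on a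 locally $C^*$-algebra $A$ is an inverse limit action. -/

import Mathlib

open Filter Topology

universe u v w

/-! ### Locally C*-algebras -/

section LocallyCStar

/-- A C*-seminorm on a complex `*`-algebra. -/
structure IsCStarSeminorm {A : Type u} [NonUnitalRing A] [StarRing A] [Module ℂ A]
    (p : Seminorm ℂ A) : Prop where
  mul_le : ∀ a b : A, p (a * b) ≤ p a * p b
  star_mul_self : ∀ a : A, p (star a * a) = p a ^ 2

/-- `S(A)`: the set of all continuous C*-seminorms on `A`. -/
def ContCStarSeminorm (A : Type u) [NonUnitalRing A] [StarRing A] [Module ℂ A]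
    [TopologicalSpace A] : Type u :=
  {p : Seminorm ℂ A // IsCStarSeminorm p ∧ Continuous p}

/-- A locally C*-algebra: a complete Hausdorff complex topological `*`-algebra (not necessarily
unital) whose topology is determined by its continuous C*-seminorms. -/
class IsLocallyCStarAlgebra (A : Type u) [NonUnitalRing A] [StarRing A] [Module ℂ A]
    [IsScalarTower ℂ A A] [SMulCommClass ℂ A A] [StarModule ℂ A]
    [UniformSpace A] [IsUniformAddGroup A] [IsTopologicalRing A] [ContinuousStar A]
    [ContinuousSMul ℂ A] : Prop where
  t2 : T2Space A
  complete : CompleteSpace A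
  withSeminorms : WithSeminorms (fun p : ContCStarSeminorm A => p.1)

/-- An approximate unit of a locally C*-algebra: an increasing net of positive elements `e i` with
`p (e i) ≤ 1` for every continuous C*-seminorm `p`, such that `e i * a → a` and `a * e i → a`
for every `a`.  (Positive elements are those of the form `star b * b`.) -/
structure IsApproxUnit {A : Type u} [NonUnitalRing A] [StarRing A] [Module ℂ A]
    [TopologicalSpace A] {ι : Type w} [Preorder ι] (e : ι → A) : Prop where
  pos : ∀ i, ∃ b : A, e i = star b * b
  mono : ∀ i j, i ≤ j → ∃ b : A, e j - e i = star b * b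
  bound : ∀ (p : ContCStarSeminorm A) (i : ι), p.1 (e i) ≤ 1
  left : ∀ a : A, Tendsto (fun i => e i * a) atTop (𝓝 a)
  right : ∀ a : A, Tendsto (fun i => a * e i) atTop (𝓝 a)

/-- A morphism `Φ : A → B ⊆ M(B)` of locally C*-algebras is an `S`-morphism when it is continuous
and, for every approximate unit `(e i)` of `A`, the net `Φ (e i)` converges to `1` in the strict
topology of `M(B)`, i.e. `Φ (e i) * b → b` and `b * Φ (e i) → b` for all `b` in `B`. -/
structure IsSMorphism {A : Type u} [NonUnitalRing A] [StarRing A] [Module ℂ A]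
    [TopologicalSpace A] {B : Type w} [NonUnitalRing B] [StarRing B] [Module ℂ B]
    [TopologicalSpace B] (Φ : A →⋆ₙₐ[ℂ] B) : Prop where
  continuous : Continuous Φ
  strict : ∀ (ι : Type u) [Preorder ι] [IsDirectedOrder ι] [Nonempty ι] (e : ι → A),
    IsApproxUnit e → ∀ b : B,
      Tendsto (fun i => Φ (e i) * b) atTop (𝓝 b) ∧ Tendsto (fun i => b * Φ (e i)) atTop (𝓝 b)

end LocallyCStar

/-! ### The commutative Kac C*-algebra of a compact group, and tensor products with it

For a compact group `G` one has `C₀(G) = C(G)`.  For a compact space `X` and a locally C*-algebra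
`A`, the injective tensor product `A ⊗ C(X)` is the algebra `C(X, A)` with the topology of uniform
convergence (for compact `X`, the compact-open topology), `a ⊗ b` being the function
`x ↦ b x • a`.  As `C(G)` is unital, `M(A, C(G))`, which consists of the `x ∈ M(A ⊗ C(G))` with
`x (1 ⊗ b)` and `(1 ⊗ b) x` in `A ⊗ C(G)` for all `b`, is `A ⊗ C(G) = C(G, A)` itself (and this is
`C_b(G, A)`).  Likewise `A ⊗ C(G) ⊗ C(G) = C(G × G, A)`. -/

section Tensor

variable {G : Type v} [Group G] [TopologicalSpace G] [IsTopologicalGroup G]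

/-- The comultiplication of the commutative Kac C*-algebra of `G`: `(d f)(s, t) = f (s t)`. -/
noncomputable def kacComul : C(G, ℂ) →⋆ₐ[ℂ] C(G × G, ℂ) :=
  ContinuousMap.compStarAlgHom' ℂ ℂ ⟨fun x : G × G => x.1 * x.2, by fun_prop⟩

/-- The flip `σ` of `C(G) ⊗ C(G) = C(G × G)`, with `σ (b ⊗ c) = c ⊗ b`. -/
noncomputable def kacFlip : C(G × G, ℂ) →⋆ₐ[ℂ] C(G × G, ℂ) :=
  ContinuousMap.compStarAlgHom' ℂ ℂ ⟨Prod.swap, continuous_swap⟩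

variable {A : Type u} [NonUnitalRing A] [Module ℂ A] [TopologicalSpace A] [ContinuousSMul ℂ A]

/-- The elementary tensor `a ⊗ b` in `A ⊗ C(X) = C(X, A)`. -/
noncomputable def elemTensor {X : Type w} [TopologicalSpace X] (a : A) (b : C(X, ℂ)) : C(X, A) :=
  ⟨fun x => b x • a, by fun_prop⟩

/-- `id_A ⊗ (σ ∘ d) : A ⊗ C(G) → A ⊗ C(G) ⊗ C(G)`, see `idTensorFlipComul_elemTensor`. -/
noncomputable def idTensorFlipComul (F : C(G, A)) : C(G × G, A) :=
  F.comp ⟨fun x : G × G => x.2 * x.1, by fun_prop⟩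

/-- `id_A ⊗ (σ ∘ d)` maps `a ⊗ b` to `a ⊗ σ (d b)`. -/
theorem idTensorFlipComul_elemTensor (a : A) (b : C(G, ℂ)) :
    idTensorFlipComul (elemTensor a b) = elemTensor a (kacFlip (kacComul b)) := rfl

/-- `α ⊗ id : A ⊗ C(G) → A ⊗ C(G) ⊗ C(G)` for a continuous `α : A → A ⊗ C(G)`,
see `tensorId_elemTensor`. -/
noncomputable def tensorId [CompactSpace G] (α : C(A, C(G, A))) (F : C(G, A)) : C(G × G, A) :=
  (ContinuousMap.uncurry (α.comp F)).comp ⟨Prod.swap, continuous_swap⟩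

/-- `α ⊗ id` maps `a ⊗ b` to `α a ⊗ b`, for linear `α`. -/
theorem tensorId_elemTensor [CompactSpace G] (α : C(A, C(G, A)))
    (hα : ∀ (c : ℂ) (a : A), α (c • a) = c • α a) (a : A) (b : C(G, ℂ)) (s t : G) :
    tensorId α (elemTensor a b) (s, t) = b t • α a s := by
  change α (b t • a) s = _
  rw [hα]; rfl

end Tensor

/-! ### Actions of the commutative Kac C*-algebra of a compact group -/

/-- An action of the commutative Kac C*-algebra of the compact group `G` on `A`: an injective
`S`-morphism `α : A → M(A, C(G)) = C(G, A)` with `(α ⊗ id) ∘ α = (id ⊗ (σ ∘ d)) ∘ α`. -/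
structure KacAction (G : Type v) [Group G] [TopologicalSpace G] [IsTopologicalGroup G]
    [CompactSpace G] (A : Type u) [NonUnitalRing A] [StarRing A] [Module ℂ A]
    [TopologicalSpace A] [IsTopologicalRing A] [ContinuousStar A] [ContinuousSMul ℂ A] where
  /-- the underlying `*`-homomorphism -/
  hom : A →⋆ₙₐ[ℂ] C(G, A)
  injective : Function.Injective hom
  sMorphism : IsSMorphism hom
  coaction : ∀ a : A,
    tensorId ⟨hom, sMorphism.continuous⟩ (hom a) = idTensorFlipComul (hom a)

/-- An inverse system of C*-algebras over a directed set. -/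
structure CStarInverseSystem where
  /-- the index set -/
  Δ : Type u
  [preorder : Preorder Δ]
  [directed : IsDirectedOrder Δ]
  [nonempty : Nonempty Δ]
  /-- the C*-algebras -/
  obj : Δ → Type u
  [cstar : ∀ δ, NonUnitalCStarAlgebra (obj δ)]
  /-- the connecting `*`-homomorphisms -/
  map : ∀ {δ ε : Δ}, ε ≤ δ → obj δ →⋆ₙₐ[ℂ] obj ε
  map_refl : ∀ (δ : Δ) (a : obj δ), map (le_refl δ) a = a
  map_trans : ∀ {δ ε ζ : Δ} (h : ε ≤ δ) (h' : ζ ≤ ε) (a : obj δ),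
    map h' (map h a) = map (h'.trans h) a

attribute [instance] CStarInverseSystem.preorder CStarInverseSystem.directed
  CStarInverseSystem.nonempty CStarInverseSystem.cstar

/-- The inverse limit: the `*`-algebra of coherent families, with the subspace topology of the
product topology. -/
def CStarInverseSystem.limit (S : CStarInverseSystem.{u}) :
    NonUnitalStarSubalgebra ℂ (∀ δ, S.obj δ) where
  carrier := {x | ∀ (δ ε : S.Δ) (h : ε ≤ δ), S.map h (x δ) = x ε}
  add_mem' := by
    intro a b ha hb δ ε h
    simp [ha δ ε h, hb δ ε h]
  zero_mem' := by
    intro δ ε h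
    simp
  mul_mem' := by
    intro a b ha hb δ ε h
    simp [ha δ ε h, hb δ ε h]
  smul_mem' := by
    intro c a ha δ ε h
    simp [ha δ ε h]
  star_mem' := by
    intro a ha δ ε h
    simp [ha δ ε h, map_star]

/-- `α` is an inverse limit action: there are an inverse system `(A_δ)` of C*-algebras, an
isomorphism of locally C*-algebras `φ : A ≃ lim A_δ`, and actions `β δ` on `A_δ` forming an inverse
system of morphisms (`(π_{δε} ⊗ id) ∘ β δ = β ε ∘ π_{δε}`) whose limit is `α`
(`(π_δ ⊗ id) ∘ α = β δ ∘ π_δ`, where `π_δ : A → A_δ` is the canonical map). -/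
def KacAction.IsInverseLimit {G : Type v} [Group G] [TopologicalSpace G] [IsTopologicalGroup G]
    [CompactSpace G] {A : Type u} [NonUnitalRing A] [StarRing A] [Module ℂ A]
    [TopologicalSpace A] [IsTopologicalRing A] [ContinuousStar A] [ContinuousSMul ℂ A]
    (α : KacAction G A) : Prop :=
  ∃ (S : CStarInverseSystem.{u}) (φ : A ≃⋆ₐ[ℂ] S.limit) (β : ∀ δ, KacAction G (S.obj δ)),
    Continuous φ ∧ Continuous φ.symm ∧
    (∀ (δ ε : S.Δ) (h : ε ≤ δ) (a : S.obj δ) (t : G),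
      S.map h ((β δ).hom a t) = (β ε).hom (S.map h a) t) ∧
    (∀ (δ : S.Δ) (a : A) (t : G),
      (φ (α.hom a t)).1 δ = (β δ).hom ((φ a).1 δ) t)

/-!
Write `α_t a = α a t`. The coaction identity says `α_s (α_t a) = α_{ts} a`, and injectivity of `α`
then forces `α_1 = id`. So `α` is a jointly continuous (right) action of the compact group `G` on
`A` by `*`-automorphisms (`KacAction.hom_hom_apply`, `KacAction.hom_apply_one`).

For a continuous C*-seminorm `p` the supremum `a ↦ sup_t p (α_t a)` is finite by compactness. It is
again a continuous C*-seminorm, it dominates `p`, and it is invariant under `α`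
(`KacAction.supSeminorm`). Hence the invariant continuous C*-seminorms form a directed set that
determines the topology of `A`. For invariant `p` let `A_p` be the Hausdorff completion of `(A, p)`,
a C*-algebra. The bound `p (α_t a) ≤ p a` lets `α` extend to a contractive `*`-homomorphism
`A_p → C(G, A_p)`, and the identities above persist by density. The `S`-morphism property is
automatic (`isSMorphism_of_contractive`): it reduces to the uniform convergence of `e_i x → x` on the
compact range of `t ↦ α_{t⁻¹} (f t)`.

Finally `A → lim A_p` is a topological embedding by cofinality of the invariant seminorms, has
dense range because each `A → A_p` does, and has closed range because `A` is complete. Working with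
completions avoids having to know that the quotients `A / ker p` are already complete.
-/

open UniformSpace

/-! ### Completions of seminormed C*-algebras -/

/-- The C*-identity for a seminorm on a `*`-ring; `CStarRing` requires a genuine norm. -/
class IsCStarNormed (E : Type u) [NonUnitalSeminormedRing E] [StarRing E] : Prop where
  norm_star_mul_self : ∀ a : E, ‖star a * a‖ = ‖a‖ ^ 2

section

variable {E : Type u} [NonUnitalSeminormedRing E] [StarRing E] [IsCStarNormed E]

/-- The C*-identity gives `‖a‖² ≤ ‖star a‖ ‖a‖`, which forces `star` to be isometric. -/
instance : NormedStarGroup E where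
  norm_star_le a := by
    have h := (IsCStarNormed.norm_star_mul_self (star a)).symm.trans_le (norm_mul_le _ _)
    rw [star_star, sq] at h
    rcases (norm_nonneg (star a)).eq_or_lt with h0 | h0
    · exact h0 ▸ norm_nonneg a
    · exact le_of_mul_le_mul_right h h0

end

namespace UniformSpace.Completion

section Ring

variable {E : Type u} [NonUnitalSeminormedRing E]

/-- Multiplication on the completion of a seminormed ring, extended by density. For unital rings
this is definitionally the multiplication of `UniformSpace.Completion.mul`. -/
noncomputable instance instMulNonUnital : Mul (Completion E) :=
  ⟨Function.curry <| (isDenseInducing_coe.prodMap isDenseInducing_coe).extend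
    ((↑) ∘ Function.uncurry ((· * ·) : E → E → E))⟩

theorem coe_mul_nonUnital (a b : E) : ((a * b : E) : Completion E) = a * b :=
  ((isDenseInducing_coe.prodMap isDenseInducing_coe).extend_eq
      ((continuous_coe E).comp (@continuous_mul E _ _ _)) (a, b)).symm

instance instContinuousMulNonUnital : ContinuousMul (Completion E) where
  continuous_mul := by
    let m := (AddMonoidHom.mul : E →+ E →+ E).compr₂ toCompl
    have : Continuous fun p : E × E => m p.1 p.2 := (continuous_coe E).comp continuous_mul
    have di : IsDenseInducing (toCompl : E → Completion E) := isDenseInducing_coe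
    exact (di.extend_Z_bilin di this :)

noncomputable instance instNonUnitalNormedRing : NonUnitalNormedRing (Completion E) where
  __ := (inferInstance : NormedAddCommGroup (Completion E))
  __ := (inferInstance : Mul (Completion E))
  zero_mul a := by
    induction a using induction_on with
    | hp => exact isClosed_eq (by fun_prop) continuous_const
    | ih a => rw [← coe_zero, ← coe_mul_nonUnital, zero_mul]
  mul_zero a := by
    induction a using induction_on with
    | hp => exact isClosed_eq (by fun_prop) continuous_const
    | ih a => rw [← coe_zero, ← coe_mul_nonUnital, mul_zero]
  mul_assoc a b c := by
    induction a, b, c using induction_on₃ with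
    | hp => exact isClosed_eq (by fun_prop) (by fun_prop)
    | ih a b c => simp only [← coe_mul_nonUnital, mul_assoc]
  left_distrib a b c := by
    induction a, b, c using induction_on₃ with
    | hp => exact isClosed_eq (by fun_prop) (by fun_prop)
    | ih a b c => simp only [← coe_mul_nonUnital, ← coe_add, mul_add]
  right_distrib a b c := by
    induction a, b, c using induction_on₃ with
    | hp => exact isClosed_eq (by fun_prop) (by fun_prop)
    | ih a b c => simp only [← coe_mul_nonUnital, ← coe_add, add_mul]
  norm_mul_le a b := by
    induction a, b using induction_on₂ with
    | hp => exact isClosed_le (by fun_prop) (by fun_prop)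
    | ih a b => simpa only [← coe_mul_nonUnital, norm_coe] using norm_mul_le a b

end Ring

section Star

variable {E : Type u} [NonUnitalSeminormedRing E] [StarRing E] [IsCStarNormed E]

noncomputable instance : Star (Completion E) := ⟨Completion.map star⟩

theorem coe_star (a : E) : ((star a : E) : Completion E) = star (a : Completion E) :=
  (map_coe star_isometry.uniformContinuous a).symm

instance : ContinuousStar (Completion E) := ⟨continuous_map⟩

noncomputable instance : StarRing (Completion E) where
  star_involutive a := by
    induction a using induction_on with
    | hp => exact isClosed_eq (by fun_prop) (by fun_prop)
    | ih a => simp only [← coe_star, star_star]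
  star_mul a b := by
    induction a, b using induction_on₂ with
    | hp => exact isClosed_eq (by fun_prop) (by fun_prop)
    | ih a b => simp only [← coe_star, ← coe_mul_nonUnital, star_mul]
  star_add a b := by
    induction a, b using induction_on₂ with
    | hp => exact isClosed_eq (by fun_prop) (by fun_prop)
    | ih a b => simp only [← coe_star, ← coe_add, star_add]

instance : CStarRing (Completion E) where
  norm_mul_self_le a := by
    induction a using induction_on with
    | hp => exact isClosed_le (by fun_prop) (by fun_prop)
    | ih a =>
      simp only [← coe_star, ← coe_mul_nonUnital, norm_coe, IsCStarNormed.norm_star_mul_self, sq,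
        le_refl]

variable [NormedSpace ℂ E]

instance [StarModule ℂ E] : StarModule ℂ (Completion E) where
  star_smul c a := by
    induction a using induction_on with
    | hp =>
      exact isClosed_eq (continuous_star.comp (continuous_const_smul c))
        ((continuous_const_smul (star c)).comp continuous_star)
    | ih a => simp only [← coe_star, ← coe_smul, star_smul]

instance [IsScalarTower ℂ E E] : IsScalarTower ℂ (Completion E) (Completion E) where
  smul_assoc c a b := by
    induction a, b using induction_on₂ with
    | hp =>
      exact isClosed_eq ((continuous_fst.const_smul c).mul continuous_snd)
        ((continuous_fst.mul continuous_snd).const_smul c)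
    | ih a b => simp only [← coe_smul, smul_eq_mul, ← coe_mul_nonUnital, smul_mul_assoc]

instance [SMulCommClass ℂ E E] : SMulCommClass ℂ (Completion E) (Completion E) where
  smul_comm c a b := by
    induction a, b using induction_on₂ with
    | hp =>
      exact isClosed_eq ((continuous_fst.mul continuous_snd).const_smul c)
        (continuous_fst.mul (continuous_snd.const_smul c))
    | ih a b => simp only [← coe_smul, smul_eq_mul, ← coe_mul_nonUnital, mul_smul_comm]

/-- The completion of a `*`-algebra with a C*-seminorm is a C*-algebra. -/
noncomputable instance [IsScalarTower ℂ E E] [SMulCommClass ℂ E E] [StarModule ℂ E] :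
    NonUnitalCStarAlgebra (Completion E) where

variable {B : Type w} [NonUnitalNormedRing B] [StarRing B] [ContinuousStar B] [NormedSpace ℂ B]
  [CompleteSpace B]

/-- The extension to the completion of a contractive `*`-homomorphism into a Banach `*`-algebra. -/
noncomputable def liftStarHom (f : E →⋆ₙₐ[ℂ] B) (hf : ∀ a, ‖f a‖ ≤ ‖a‖) :
    Completion E →⋆ₙₐ[ℂ] B :=
  have hu : UniformContinuous f :=
    AddMonoidHomClass.uniformContinuous_of_bound f 1 (by simpa using hf)
  { toFun := Completion.extension f
    map_smul' := fun c a => by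
      induction a using induction_on with
      | hp =>
        exact isClosed_eq (continuous_extension.comp (continuous_const_smul c))
          (continuous_extension.const_smul _)
      | ih a => simp [← coe_smul, extension_coe hu, map_smul]
    map_zero' := by rw [← coe_zero, extension_coe hu, map_zero]
    map_add' := fun a b => by
      induction a, b using induction_on₂ with
      | hp =>
        exact isClosed_eq (continuous_extension.comp continuous_add)
          ((continuous_extension.comp continuous_fst).add
            (continuous_extension.comp continuous_snd))
      | ih a b => simp only [← coe_add, extension_coe hu, map_add]
    map_mul' := fun a b => by
      induction a, b using induction_on₂ with
      | hp =>
        exact isClosed_eq (continuous_extension.comp continuous_mul)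
          ((continuous_extension.comp continuous_fst).mul
            (continuous_extension.comp continuous_snd))
      | ih a b => simp only [← coe_mul_nonUnital, extension_coe hu, map_mul]
    map_star' := fun a => by
      induction a using induction_on with
      | hp =>
        exact isClosed_eq (continuous_extension.comp continuous_star)
          (continuous_extension.star)
      | ih a => simp only [← coe_star, extension_coe hu, map_star] }

variable (f : E →⋆ₙₐ[ℂ] B) (hf : ∀ a, ‖f a‖ ≤ ‖a‖)

theorem liftStarHom_coe (a : E) : liftStarHom f hf a = f a :=
  extension_coe (AddMonoidHomClass.uniformContinuous_of_bound f 1 (by simpa using hf)) a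

theorem continuous_liftStarHom : Continuous (liftStarHom f hf) :=
  continuous_extension

theorem norm_liftStarHom_le (a : Completion E) : ‖liftStarHom f hf a‖ ≤ ‖a‖ := by
  induction a using induction_on with
  | hp => exact isClosed_le (continuous_liftStarHom f hf).norm continuous_norm
  | ih a => simpa only [liftStarHom_coe, norm_coe] using hf a

end Star

end UniformSpace.Completion

/-! ### The C*-algebra of a continuous C*-seminorm -/

section SeminormCompletion

variable {A : Type u} [NonUnitalRing A] [StarRing A] [Module ℂ A] [TopologicalSpace A]

/-- The `*`-algebra `A` with the topology of the single C*-seminorm `p`. -/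
def ContCStarSeminorm.Space (_p : ContCStarSeminorm A) : Type u := A

namespace ContCStarSeminorm

variable (p : ContCStarSeminorm A)

noncomputable instance : NonUnitalSeminormedRing p.Space where
  __ := (inferInstanceAs (NonUnitalRing A) : NonUnitalRing p.Space)
  __ := (p.1.toSeminormedAddCommGroup : SeminormedAddCommGroup A)
  norm_mul_le := p.2.1.mul_le

noncomputable instance : StarRing p.Space := inferInstanceAs (StarRing A)

instance : IsCStarNormed p.Space := ⟨p.2.1.star_mul_self⟩

noncomputable instance : NormedSpace ℂ p.Space where
  __ := (inferInstanceAs (Module ℂ A) : Module ℂ p.Space)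
  norm_smul_le c a := (map_smul_eq_mul p.1 c a).le

instance [IsScalarTower ℂ A A] : IsScalarTower ℂ p.Space p.Space :=
  inferInstanceAs (IsScalarTower ℂ A A)

instance [SMulCommClass ℂ A A] : SMulCommClass ℂ p.Space p.Space :=
  inferInstanceAs (SMulCommClass ℂ A A)

instance [StarModule ℂ A] : StarModule ℂ p.Space := inferInstanceAs (StarModule ℂ A)

/-- The Hausdorff completion of `A` for the C*-seminorm `p`. -/
abbrev Compl : Type u := Completion p.Space

/-- The canonical `*`-homomorphism from `A` to its completion for `p`. -/
noncomputable def toCompl : A →⋆ₙₐ[ℂ] p.Compl where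
  toFun a := Completion.coe' (α := p.Space) a
  map_smul' c a := Completion.coe_smul (X := p.Space) c a
  map_zero' := rfl
  map_add' a b := Completion.coe_add (α := p.Space) a b
  map_mul' a b := Completion.coe_mul_nonUnital (E := p.Space) a b
  map_star' a := Completion.coe_star (E := p.Space) a

theorem norm_toCompl (a : A) : ‖p.toCompl a‖ = p.1 a :=
  Completion.norm_coe (E := p.Space) a

theorem denseRange_toCompl : DenseRange p.toCompl :=
  Completion.denseRange_coe (α := p.Space)

theorem continuous_toCompl [IsTopologicalAddGroup A] : Continuous p.toCompl := by
  refine continuous_iff_continuousAt.2 fun a => ?_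
  rw [ContinuousAt, tendsto_iff_norm_sub_tendsto_zero]
  simp_rw [← map_sub, norm_toCompl]
  have h : Continuous fun x => p.1 (x - a) := p.2.2.comp (by fun_prop)
  simpa using h.tendsto a

variable {B : Type w} [NonUnitalNormedRing B] [StarRing B] [ContinuousStar B] [NormedSpace ℂ B]
  [CompleteSpace B]

variable {p} in
/-- A `*`-homomorphism from `A` into a Banach `*`-algebra that is bounded by `p` extends to the
completion for `p`. -/
noncomputable def lift (f : A →⋆ₙₐ[ℂ] B) (hf : ∀ a, ‖f a‖ ≤ p.1 a) : p.Compl →⋆ₙₐ[ℂ] B :=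
  Completion.liftStarHom (E := p.Space) { f with } hf

section

variable {p} (f : A →⋆ₙₐ[ℂ] B) (hf : ∀ a, ‖f a‖ ≤ p.1 a)

theorem lift_toCompl (a : A) : lift f hf (p.toCompl a) = f a :=
  Completion.liftStarHom_coe (E := p.Space) _ _ a

theorem continuous_lift : Continuous (lift f hf) :=
  Completion.continuous_liftStarHom (E := p.Space) _ _

theorem norm_lift_le (x : p.Compl) : ‖lift f hf x‖ ≤ ‖x‖ :=
  Completion.norm_liftStarHom_le (E := p.Space) _ _ x

end

variable {p} {q r : ContCStarSeminorm A}

/-- The connecting `*`-homomorphism between completions for comparable C*-seminorms. -/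
noncomputable def complMap (h : p.1 ≤ q.1) : q.Compl →⋆ₙₐ[ℂ] p.Compl :=
  lift p.toCompl fun a => (p.norm_toCompl a).trans_le (h a)

theorem complMap_toCompl (h : p.1 ≤ q.1) (a : A) :
    complMap h (q.toCompl a) = p.toCompl a :=
  lift_toCompl _ _ a

theorem continuous_complMap (h : p.1 ≤ q.1) : Continuous (complMap h) :=
  continuous_lift _ _

theorem norm_complMap_sub_le (h : p.1 ≤ q.1) (x y : q.Compl) :
    ‖complMap h x - complMap h y‖ ≤ ‖x - y‖ := by
  rw [← map_sub]
  exact norm_lift_le _ _ _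

theorem complMap_refl (x : p.Compl) : complMap (le_refl p.1) x = x :=
  congrFun (p.denseRange_toCompl.equalizer (continuous_complMap _) continuous_id
    (funext fun a => complMap_toCompl _ a)) x

theorem complMap_complMap (h : p.1 ≤ q.1) (h' : q.1 ≤ r.1) (x : r.Compl) :
    complMap h (complMap h' x) = complMap (h.trans h') x :=
  congrFun (r.denseRange_toCompl.equalizer
    ((continuous_complMap h).comp (continuous_complMap h')) (continuous_complMap _)
    (funext fun a => by simp only [Function.comp_apply, complMap_toCompl])) x

/-- The pointwise maximum of two continuous C*-seminorms. -/
noncomputable def max (p q : ContCStarSeminorm A) : ContCStarSeminorm A :=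
  ⟨p.1 ⊔ q.1,
    { mul_le := fun a b => sup_le
        ((p.2.1.mul_le a b).trans (mul_le_mul le_sup_left le_sup_left (apply_nonneg _ _)
          (apply_nonneg (p.1 ⊔ q.1) a)))
        ((q.2.1.mul_le a b).trans (mul_le_mul le_sup_right le_sup_right (apply_nonneg _ _)
          (apply_nonneg (p.1 ⊔ q.1) a)))
      star_mul_self := fun a => by
        rw [Seminorm.sup_apply, Seminorm.sup_apply, p.2.1.star_mul_self, q.2.1.star_mul_self]
        exact ((pow_left_monotoneOn (n := 2)).map_max (apply_nonneg p.1 a)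
          (apply_nonneg q.1 a)).symm },
    p.2.2.max q.2.2⟩

/-- The zero C*-seminorm. -/
noncomputable def zero : ContCStarSeminorm A :=
  ⟨0, ⟨fun a b => by simp, fun a => by simp⟩, continuous_const⟩

end ContCStarSeminorm

end SeminormCompletion

/-! ### Strict convergence of approximate units on compact sets -/

/-- A pointwise convergent net of contractions converges uniformly on compact sets. -/
theorem eventually_norm_sub_lt_of_isCompact {B : Type u} [NormedAddCommGroup B] {ι : Type w}
    {l : Filter ι} {T : ι → B →+ B} (hT : ∀ i x, ‖T i x‖ ≤ ‖x‖)
    (h : ∀ x, Tendsto (fun i => T i x) l (𝓝 x)) {K : Set B} (hK : IsCompact K) {ε : ℝ}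
    (hε : 0 < ε) : ∀ᶠ i in l, ∀ x ∈ K, ‖T i x - x‖ < ε := by
  obtain ⟨s, -, hs, hKs⟩ := hK.finite_cover_balls (show 0 < ε / 3 by positivity)
  have h' : ∀ᶠ i in l, ∀ y ∈ s, ‖T i y - y‖ < ε / 3 := by
    rw [eventually_all_finite hs]
    intro y _
    simpa [dist_eq_norm] using (Metric.tendsto_nhds.1 (h y)) (ε / 3) (by positivity)
  filter_upwards [h'] with i hi x hx
  obtain ⟨y, hy, hxy⟩ := Set.mem_iUnion₂.1 (hKs hx)
  rw [Metric.mem_ball, dist_eq_norm] at hxy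
  calc ‖T i x - x‖ = ‖T i (x - y) + (T i y - y) - (x - y)‖ := by rw [map_sub]; congr 1; abel
    _ ≤ ‖T i (x - y)‖ + ‖T i y - y‖ + ‖x - y‖ :=
      (norm_sub_le _ _).trans (add_le_add_left (norm_add_le _ _) _)
    _ < ε := by linarith [hT i (x - y), hi y hy]

/-- In a C*-algebra the norm is one of the continuous C*-seminorms, so approximate units are
norm-bounded by `1`. -/
theorem IsApproxUnit.norm_le_one {B : Type u} [NonUnitalCStarAlgebra B] {ι : Type w} [Preorder ι]
    {e : ι → B} (he : IsApproxUnit e) (i : ι) : ‖e i‖ ≤ 1 :=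
  he.bound ⟨normSeminorm ℂ B, ⟨fun a b => norm_mul_le a b, fun a => by
    simpa [sq] using CStarRing.norm_star_mul_self (x := a)⟩, continuous_norm⟩ i

section Group

variable {G : Type v} [Group G] [TopologicalSpace G] [IsTopologicalGroup G] [CompactSpace G]

/-- On a C*-algebra, the `S`-morphism property is automatic for a contractive `Φ : B → C(G, B)`
with `Φ ∘ Φ` given by the multiplication of `G` and with `Φ · 1 = id`. At `t` one has
`Φ(e) f - f = Φ (e g - g)` with `g t = Φ (f t) t⁻¹`, and `g` has compact range. -/
theorem isSMorphism_of_contractive {B : Type u} [NonUnitalCStarAlgebra B]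
    (Φ : B →⋆ₙₐ[ℂ] C(G, B)) (hΦ : ∀ x, ‖Φ x‖ ≤ ‖x‖) (h1 : ∀ x, Φ x 1 = x)
    (hmul : ∀ x s t, Φ (Φ x t) s = Φ x (t * s)) : IsSMorphism Φ := by
  have hc : Continuous Φ :=
    (AddMonoidHomClass.lipschitz_of_bound Φ 1 (by simpa using hΦ)).continuous
  refine ⟨hc, fun ι _ _ _ e he f => ?_⟩
  have hn (x : B) (t : G) : ‖Φ x t‖ ≤ ‖x‖ := ((Φ x).norm_coe_le_norm t).trans (hΦ x)
  let g : G → B := fun t => Φ (f t) t⁻¹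
  have hg : Continuous g :=
    continuous_eval.comp ((hc.comp f.continuous).prodMk continuous_inv)
  have hgf (t : G) : Φ (g t) t = f t := by simp only [g, hmul, inv_mul_cancel, h1]
  have hK : IsCompact (Set.range g) := isCompact_range hg
  constructor
  · rw [Metric.tendsto_nhds]
    intro ε hε
    have hT (i : ι) (x : B) : ‖AddMonoidHom.mulLeft (e i) x‖ ≤ ‖x‖ :=
      (norm_mul_le _ _).trans (mul_le_of_le_one_left (norm_nonneg _) (he.norm_le_one i))
    filter_upwards [eventually_norm_sub_lt_of_isCompact hT he.left hK hε] with i hi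
    rw [dist_eq_norm, ContinuousMap.norm_lt_iff _ hε]
    intro t
    have : (Φ (e i) * f - f) t = Φ (e i * g t - g t) t := by
      simp [map_sub, map_mul, hgf]
    rw [this]
    exact (hn _ t).trans_lt (hi _ ⟨t, rfl⟩)
  · rw [Metric.tendsto_nhds]
    intro ε hε
    have hT (i : ι) (x : B) : ‖AddMonoidHom.mulRight (e i) x‖ ≤ ‖x‖ :=
      (norm_mul_le _ _).trans (mul_le_of_le_one_right (norm_nonneg _) (he.norm_le_one i))
    filter_upwards [eventually_norm_sub_lt_of_isCompact hT he.right hK hε] with i hi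
    rw [dist_eq_norm, ContinuousMap.norm_lt_iff _ hε]
    intro t
    have : (f * Φ (e i) - f) t = Φ (g t * e i - g t) t := by
      simp [map_sub, map_mul, hgf]
    rw [this]
    exact (hn _ t).trans_lt (hi _ ⟨t, rfl⟩)

/-! ### Invariant C*-seminorms -/

namespace KacAction

variable {A : Type u} [NonUnitalRing A] [StarRing A] [Module ℂ A] [TopologicalSpace A]
  [IsTopologicalRing A] [ContinuousStar A] [ContinuousSMul ℂ A] (α : KacAction G A)

theorem hom_hom_apply (a : A) (s t : G) : α.hom (α.hom a t) s = α.hom a (t * s) :=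
  DFunLike.congr_fun (α.coaction a) (s, t)

/-- The unit of `G` acts trivially: `a` and `α a 1` have the same image under the injective `α`. -/
theorem hom_apply_one (a : A) : α.hom a 1 = a :=
  α.injective (ContinuousMap.ext fun s => by rw [hom_hom_apply, one_mul])

/-- For a continuous seminorm `p`, the function `t ↦ p (α_t a)` in `C(G, ℝ)`; its norm is
`sup_t p (α_t a)`. -/
noncomputable def orbitFun (p : ContCStarSeminorm A) (a : A) : C(G, ℝ) :=
  (⟨p.1, p.2.2⟩ : C(A, ℝ)).comp (α.hom a)

theorem orbitFun_apply (p : ContCStarSeminorm A) (a : A) (t : G) :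
    α.orbitFun p a t = p.1 (α.hom a t) := rfl

theorem le_norm_orbitFun (p : ContCStarSeminorm A) (a : A) (t : G) :
    p.1 (α.hom a t) ≤ ‖α.orbitFun p a‖ :=
  (le_abs_self _).trans ((α.orbitFun p a).norm_coe_le_norm t)

theorem norm_orbitFun_le (p : ContCStarSeminorm A) {a : A} {C : ℝ}
    (h : ∀ t, p.1 (α.hom a t) ≤ C) : ‖α.orbitFun p a‖ ≤ C :=
  (ContinuousMap.norm_le_of_nonempty _).2 fun t => by
    rw [orbitFun_apply, Real.norm_of_nonneg (apply_nonneg _ _)]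
    exact h t

theorem continuous_norm_orbitFun (p : ContCStarSeminorm A) :
    Continuous fun a => ‖α.orbitFun p a‖ :=
  continuous_norm.comp ((ContinuousMap.continuous_postcomp _).comp α.sMorphism.continuous)

/-- The C*-seminorm `a ↦ sup_t p (α_t a)`. -/
noncomputable def supSeminorm (p : ContCStarSeminorm A) : ContCStarSeminorm A :=
  ⟨Seminorm.of (fun a => ‖α.orbitFun p a‖)
    (fun a b => α.norm_orbitFun_le p fun t => by
      rw [map_add, ContinuousMap.add_apply]
      exact (map_add_le_add p.1 _ _).trans
        (add_le_add (α.le_norm_orbitFun p a t) (α.le_norm_orbitFun p b t)))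
    (fun c a => by
      have : α.orbitFun p (c • a) = ‖c‖ • α.orbitFun p a := by
        ext t
        simp [orbitFun_apply, map_smul, map_smul_eq_mul]
      rw [this, norm_smul, norm_norm]),
    { mul_le := fun a b => α.norm_orbitFun_le p fun t => by
        rw [map_mul, ContinuousMap.mul_apply]
        exact (p.2.1.mul_le _ _).trans
          (mul_le_mul (α.le_norm_orbitFun p a t) (α.le_norm_orbitFun p b t) (apply_nonneg _ _)
            (norm_nonneg (α.orbitFun p a)))
      star_mul_self := fun a => by
        have : α.orbitFun p (star a * a) = star (α.orbitFun p a) * α.orbitFun p a := by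
          ext t
          simp [orbitFun_apply, map_mul, map_star, p.2.1.star_mul_self, sq]
        change ‖α.orbitFun p (star a * a)‖ = ‖α.orbitFun p a‖ ^ 2
        rw [this, sq]
        exact CStarRing.norm_star_mul_self },
    α.continuous_norm_orbitFun p⟩

theorem le_supSeminorm (p : ContCStarSeminorm A) : p.1 ≤ (α.supSeminorm p).1 := fun a => by
  have h := α.le_norm_orbitFun p a 1
  rwa [hom_apply_one] at h

/-- A C*-seminorm `p` is invariant if `p (α_t a) ≤ p a` for all `t` (hence with equality, as `t`
ranges over a group). -/
def IsInvariant (p : ContCStarSeminorm A) : Prop :=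
  ∀ (a : A) (t : G), p.1 (α.hom a t) ≤ p.1 a

theorem isInvariant_supSeminorm (p : ContCStarSeminorm A) : α.IsInvariant (α.supSeminorm p) :=
  fun a s => α.norm_orbitFun_le p fun t => by
    rw [hom_hom_apply]
    exact α.le_norm_orbitFun p a (s * t)

/-! ### The induced actions on the completions -/


/-- Pushing `α` forward along `A → A_p`. -/
noncomputable def toComplHom (p : ContCStarSeminorm A) : A →⋆ₙₐ[ℂ] C(G, p.Compl) where
  toFun a := (⟨p.toCompl, p.continuous_toCompl⟩ : C(A, p.Compl)).comp (α.hom a)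
  map_smul' c a := by ext t; simp [map_smul]
  map_zero' := by ext t; simp
  map_add' a b := by ext t; simp
  map_mul' a b := by ext t; simp
  map_star' a := by ext t; simp [map_star]

theorem toComplHom_apply (a : A) (t : G) : α.toComplHom p a t = p.toCompl (α.hom a t) := rfl

variable [IsScalarTower ℂ A A] [SMulCommClass ℂ A A] [StarModule ℂ A]

section

variable {p q : ContCStarSeminorm A}

/-- The `*`-homomorphism `A_p → C(G, A_p)` induced by `α` for an invariant `p`. -/
noncomputable def complHom (hp : α.IsInvariant p) : p.Compl →⋆ₙₐ[ℂ] C(G, p.Compl) :=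
  ContCStarSeminorm.lift (α.toComplHom p) fun a =>
    (ContinuousMap.norm_le_of_nonempty _).2 fun t => by
      rw [toComplHom_apply, p.norm_toCompl]
      exact hp a t

variable (hp : α.IsInvariant p)

theorem continuous_complHom : Continuous (α.complHom hp) :=
  ContCStarSeminorm.continuous_lift _ _

theorem complHom_toCompl (a : A) (t : G) :
    α.complHom hp (p.toCompl a) t = p.toCompl (α.hom a t) :=
  DFunLike.congr_fun (ContCStarSeminorm.lift_toCompl _ _ a) t

theorem continuous_complHom_apply (t : G) : Continuous fun x => α.complHom hp x t :=
  (continuous_eval_const t).comp (α.continuous_complHom hp)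

theorem complHom_apply_one (x : p.Compl) : α.complHom hp x 1 = x :=
  congrFun (p.denseRange_toCompl.equalizer (α.continuous_complHom_apply hp 1) continuous_id
    (funext fun a => by simp [complHom_toCompl, hom_apply_one])) x

theorem complHom_complHom_apply (x : p.Compl) (s t : G) :
    α.complHom hp (α.complHom hp x t) s = α.complHom hp x (t * s) :=
  congrFun (p.denseRange_toCompl.equalizer
    ((α.continuous_complHom_apply hp s).comp (α.continuous_complHom_apply hp t))
    (α.continuous_complHom_apply hp (t * s))
    (funext fun a => by simp [complHom_toCompl, hom_hom_apply])) x

/-- The action induced by `α` on the completion for an invariant C*-seminorm. -/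
noncomputable def complAction (hp : α.IsInvariant p) : KacAction G p.Compl where
  hom := α.complHom hp
  injective x y h := by
    rw [← α.complHom_apply_one hp x, h, complHom_apply_one]
  sMorphism := isSMorphism_of_contractive _ (ContCStarSeminorm.norm_lift_le _ _)
    (α.complHom_apply_one hp) (α.complHom_complHom_apply hp)
  coaction x := ContinuousMap.ext fun y => α.complHom_complHom_apply hp x y.1 y.2

theorem complMap_complHom (hq : α.IsInvariant q) (h : p.1 ≤ q.1) (x : q.Compl) (t : G) :
    ContCStarSeminorm.complMap h (α.complHom hq x t) =
      α.complHom hp (ContCStarSeminorm.complMap h x) t :=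
  congrFun (q.denseRange_toCompl.equalizer
    ((ContCStarSeminorm.continuous_complMap h).comp (α.continuous_complHom_apply hq t))
    ((α.continuous_complHom_apply hp t).comp (ContCStarSeminorm.continuous_complMap h))
    (funext fun a => by
      simp only [Function.comp_apply, complHom_toCompl, ContCStarSeminorm.complMap_toCompl])) x

end

/-! ### The inverse system of invariant C*-seminorms -/

/-- The inverse system of the completions of `A` for the invariant continuous C*-seminorms. -/
noncomputable def invariantSystem : CStarInverseSystem.{u} where
  Δ := {p : ContCStarSeminorm A // α.IsInvariant p}
  preorder := Preorder.lift fun p => p.1.1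
  directed := ⟨fun p q => ⟨⟨p.1.max q.1, fun a t => sup_le_sup (p.2 a t) (q.2 a t)⟩,
    (le_sup_left : p.1.1 ≤ p.1.1 ⊔ q.1.1), (le_sup_right : q.1.1 ≤ p.1.1 ⊔ q.1.1)⟩⟩
  nonempty := ⟨⟨.zero, fun _ _ => le_rfl⟩⟩
  obj p := p.1.Compl
  map h := ContCStarSeminorm.complMap h
  map_refl _ := ContCStarSeminorm.complMap_refl
  map_trans h h' := ContCStarSeminorm.complMap_complMap h' h

/-- The canonical `*`-homomorphism from `A` to the inverse limit. -/
noncomputable def toLimit : A →⋆ₙₐ[ℂ] α.invariantSystem.limit where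
  toFun a := ⟨fun p => p.1.toCompl a, fun _ _ h => ContCStarSeminorm.complMap_toCompl h a⟩
  map_smul' c a := Subtype.ext (funext fun p => map_smul p.1.toCompl c a)
  map_zero' := Subtype.ext (funext fun p => map_zero p.1.toCompl)
  map_add' a b := Subtype.ext (funext fun p => map_add p.1.toCompl a b)
  map_mul' a b := Subtype.ext (funext fun p => map_mul p.1.toCompl a b)
  map_star' a := Subtype.ext (funext fun p => map_star p.1.toCompl a)

theorem continuous_toLimit : Continuous α.toLimit :=
  (continuous_pi fun p => p.1.continuous_toCompl).subtype_mk _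

theorem denseRange_toLimit : DenseRange α.toLimit := by
  intro x
  -- Approximate `x` at the index `q` within `1 / (n + 1)`; this controls all indices below `q`.
  have hex (j : α.invariantSystem.Δ × ℕ) :
      ∃ a : A, ‖x.1 j.1 - (α.toLimit a).1 j.1‖ < 1 / ((j.2 : ℝ) + 1) := by
    have hd : DenseRange fun a => (α.toLimit a).1 j.1 := j.1.1.denseRange_toCompl
    simpa only [dist_eq_norm] using hd.exists_dist_lt (x.1 j.1)
      (Nat.one_div_pos_of_nat (α := ℝ) (n := j.2))
  choose a ha using hex
  refine mem_closure_of_tendsto (f := fun j => α.toLimit (a j)) (b := atTop ×ˢ atTop) ?_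
    (Eventually.of_forall fun j => Set.mem_range_self _)
  rw [tendsto_subtype_rng, tendsto_pi_nhds]
  intro p
  rw [tendsto_iff_norm_sub_tendsto_zero]
  have hlim : Tendsto (fun j : α.invariantSystem.Δ × ℕ => 1 / ((j.2 : ℝ) + 1))
      (atTop ×ˢ atTop) (𝓝 0) :=
    tendsto_one_div_add_atTop_nhds_zero_nat.comp tendsto_snd
  refine squeeze_zero' (Eventually.of_forall fun _ => norm_nonneg _) ?_ hlim
  filter_upwards [tendsto_fst.eventually (eventually_ge_atTop p)] with j hj
  have hx : x.1 p = ContCStarSeminorm.complMap hj (x.1 j.1) := (x.2 j.1 p hj).symm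
  have hy : (α.toLimit (a j)).1 p = ContCStarSeminorm.complMap hj ((α.toLimit (a j)).1 j.1) :=
    (ContCStarSeminorm.complMap_toCompl hj (a j)).symm
  rw [hx, hy]
  refine (ContCStarSeminorm.norm_complMap_sub_le hj _ _).trans ?_
  exact (norm_sub_rev _ _).trans_le (ha j).le

end KacAction

end Group

/-! ### The inverse limit of the completions is `A` -/

namespace KacAction

variable {G : Type v} [Group G] [TopologicalSpace G] [IsTopologicalGroup G] [CompactSpace G]
  {A : Type u} [NonUnitalRing A] [StarRing A] [Module ℂ A]
  [IsScalarTower ℂ A A] [SMulCommClass ℂ A A] [StarModule ℂ A]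
  [UniformSpace A] [IsUniformAddGroup A] [IsTopologicalRing A] [ContinuousStar A]
  [ContinuousSMul ℂ A] [IsLocallyCStarAlgebra A] (α : KacAction G A)

/-- The topology of `A` is that of the inverse limit, since every continuous C*-seminorm is
dominated by an invariant one. -/
theorem isInducing_toLimit : IsInducing α.toLimit := by
  refine isInducing_iff_nhds.2 fun a =>
    le_antisymm (α.continuous_toLimit.tendsto a).le_comap ?_
  refine tendsto_id'.1 <|
    (IsLocallyCStarAlgebra.withSeminorms.tendsto_nhds id a).2 fun p ε hε => ?_
  let q : α.invariantSystem.Δ := ⟨α.supSeminorm p, α.isInvariant_supSeminorm p⟩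
  have hq : Tendsto (fun b => (α.toLimit b).1 q) (comap α.toLimit (𝓝 (α.toLimit a)))
      (𝓝 ((α.toLimit a).1 q)) :=
    (((continuous_apply q).comp continuous_subtype_val).tendsto (α.toLimit a)).comp tendsto_comap
  filter_upwards [Metric.tendsto_nhds.1 hq ε hε] with b hb
  have h : ‖q.1.toCompl b - q.1.toCompl a‖ < ε := by rwa [dist_eq_norm] at hb
  rw [← map_sub, q.1.norm_toCompl] at h
  exact (α.le_supSeminorm p (b - a)).trans_lt h

theorem bijective_toLimit : Function.Bijective α.toLimit := by
  have := IsLocallyCStarAlgebra.t2 (A := A)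
  have := IsLocallyCStarAlgebra.complete (A := A)
  refine ⟨α.isInducing_toLimit.injective, ?_⟩
  have : IsUniformAddGroup α.invariantSystem.limit :=
    isUniformEmbedding_subtype_val.isUniformInducing.isUniformAddGroup
      (NonUnitalStarSubalgebraClass.subtype α.invariantSystem.limit)
  have hu : IsUniformInducing α.toLimit :=
    AddMonoidHom.isUniformInducing_of_isInducing α.isInducing_toLimit
  rw [← Set.range_eq_univ, ← α.denseRange_toLimit.closure_range]
  exact hu.isComplete_range.isClosed.closure_eq.symm

end KacAction

theorem corollary4p5 {G : Type v} [Group G] [TopologicalSpace G] [IsTopologicalGroup G]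
    [CompactSpace G] [T2Space G]
    {A : Type u} [NonUnitalRing A] [StarRing A] [Module ℂ A]
    [IsScalarTower ℂ A A] [SMulCommClass ℂ A A] [StarModule ℂ A]
    [UniformSpace A] [IsUniformAddGroup A] [IsTopologicalRing A] [ContinuousStar A]
    [ContinuousSMul ℂ A] [IsLocallyCStarAlgebra A]
    (α : KacAction G A) : α.IsInverseLimit := by
  let φ : A ≃⋆ₐ[ℂ] α.invariantSystem.limit :=
    StarAlgEquiv.ofBijective α.toLimit α.bijective_toLimit
  refine ⟨α.invariantSystem, φ, fun p => α.complAction p.2, α.continuous_toLimit, ?_, ?_, ?_⟩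
  · refine α.isInducing_toLimit.continuous_iff.2 (continuous_id.congr fun x => ?_)
    exact (φ.apply_symm_apply x).symm
  · exact fun p q h x t => α.complMap_complHom q.2 p.2 h x t
  · exact fun p a t => (α.complHom_toCompl p.2 a t).symm
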